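/- For a real number $x$ let $\|x\|=\min_{n\in\mathbb Z}|x-n|$, and for an irrational real number $\alpha$ let $$\tau(\alpha)=\sup\Big\{\theta\in\mathbb R:\ \liminf_{q\to\infty,\ q\in\mathbb N} q^{\theta}\,\|q\alpha\|=0\Big\}$$ be its type, where the lower limit and the supremum are taken in the extended reals $\overline{\mathbb R}=\mathbb R\cup\{-\infty,\infty\}$. Call a function $f$ from a Polish space $X$ into a subset $K\subseteq\overline{\mathbb R}$ upper semi-Baire class $1$ if, for every real number $r$, the set $\{x\in X: f(x)<r\}$ is $\boldsymbol\Sigma^0_2$, i.e. a countable union of closed subsets of $X$. Theorem. The type function $\tau$ on $\mathbb R\setminus\mathbb Q$ (with the subspace topology of $\mathbb R$) is $[1,\infty]$-upper semi-Baire class $1$ complete. That is: $\tau(\alpha)\in[1,\infty]$ for every irrational $\alpha$; the function $\tau:\mathbb R\setminus\mathbb Q\to[1,\infty]$ is upper semi-Baire class $1$; and for every upper semi-Baire class $1$ function $g:2^\omega\to[1,\infty]$ on the Cantor space $2^\omega=\{0,1\}^{\mathbb N}$ (with the product topology) there is a continuous map $\rho:2^\omega\to\mathbb R\setminus\mathbb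 Q$ such that $g=\tau\circ\rho$. -/

import Mathlib

/-- The distance `min_{n ∈ ℤ} |x - n|` from a real number to the nearest integer. -/
noncomputable def nearInt (x : ℝ) : ℝ := ⨅ n : ℤ, |x - (n : ℝ)|

/-- The type of an irrational number,
`τ(α) = sup {θ ∈ ℝ : liminf_{q → ∞} q ^ θ * nearInt (q α) = 0}`.
The lower limit and the supremum are taken in the extended reals, so that both always exist. -/
noncomputable def irrType (α : {x : ℝ // Irrational x}) : EReal :=
  sSup ((fun θ : ℝ => (θ : EReal)) ''
    {θ : ℝ | Filter.liminf
      (fun q : ℕ => (((q : ℝ) ^ θ * nearInt ((q : ℝ) * (α : ℝ)) : ℝ) : EReal))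
      Filter.atTop = 0})

/-- The class `Σ⁰₂` of subsets of a topological space: countable unions of closed sets. -/
def IsSigma02 {X : Type*} [TopologicalSpace X] (A : Set X) : Prop :=
  ∃ F : ℕ → Set X, (∀ n, IsClosed (F n)) ∧ A = ⋃ n, F n

/-- An extended-real-valued function is upper semi-Baire class 1 if the preimage of `[-∞, r)`
is a `Σ⁰₂` set for every real number `r`. -/
def UpperSemiBaireOne {X : Type*} [TopologicalSpace X] (f : X → EReal) : Prop :=
  ∀ r : ℝ, IsSigma02 (f ⁻¹' Set.Iio (r : EReal))

/-- `f` is `K`-upper semi-Baire class 1 complete: it is an upper semi-Baire class 1 function with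
values in `K`, and every upper semi-Baire class 1 function `g` from the Cantor space to `K` has
the form `f ∘ φ` with `φ` continuous. -/
structure UpperSemiBaireOneComplete {X : Type*} [TopologicalSpace X] (K : Set EReal)
    (f : X → EReal) : Prop where
  mem : ∀ x, f x ∈ K
  upperSemiBaireOne : UpperSemiBaireOne f
  exists_continuous : ∀ g : (ℕ → Bool) → EReal, (∀ x, g x ∈ K) → UpperSemiBaireOne g →
    ∃ φ : (ℕ → Bool) → X, Continuous φ ∧ g = f ∘ φ

/-! Dirichlet's theorem gives `1 ≤ τ`. The set `τ < r` is a countable union over a rational exponent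
`s < r`, a bound `1 / (k + 1)` and a threshold `N` of closed conditions on all `q ≥ N`. For
completeness, `g` is written as an upper limit of functions `c t ≥ 1` of finitely many digits
(`UpperSemiBaireOne.exists_upper_limit`). A continued fraction is then built with denominators
`q_{n+1} ≈ q_n ^ c n`. Since `‖q_n α‖ ≲ 1 / q_{n+1}` and `‖q α‖ ≳ 1 / q_{n+1}` for `0 < q <
q_{n+1}`, its type is the upper limit of `c n`. The first `n` values of `c` fix the `n`-th
convergent, whence continuity. -/

open Filter Topology

/-! ### The distance to the nearest integer -/

theorem nearInt_le (x : ℝ) (n : ℤ) : nearInt x ≤ |x - n| :=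
  ciInf_le ⟨0, by rintro _ ⟨m, rfl⟩; exact abs_nonneg _⟩ n

theorem nearInt_eq_abs_sub_round (x : ℝ) : nearInt x = |x - round x| :=
  le_antisymm (nearInt_le x _) (le_ciInf fun n => round_le x n)

theorem nearInt_nonneg (x : ℝ) : 0 ≤ nearInt x := by
  rw [nearInt_eq_abs_sub_round]; exact abs_nonneg _

theorem nearInt_pos {x : ℝ} (hx : Irrational x) : 0 < nearInt x := by
  rw [nearInt_eq_abs_sub_round]
  exact abs_pos.2 (sub_ne_zero.2 (hx.ne_int _))

/-! ### The type of an irrational number -/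

theorem liminf_coe_eq_zero_iff {f : ℕ → ℝ} (hf : ∀ q, 0 ≤ f q) :
    liminf (fun q => (f q : EReal)) atTop = 0 ↔ ∀ ε : ℝ, 0 < ε → ∃ᶠ q in atTop, f q < ε := by
  constructor
  · intro h ε hε
    have : liminf (fun q => (f q : EReal)) atTop < (ε : EReal) := by
      rw [h]; exact_mod_cast hε
    exact (frequently_lt_of_liminf_lt (by isBoundedDefault) this).mono
      fun q hq => by exact_mod_cast hq
  · intro h
    apply le_antisymm
    · refine le_of_forall_gt_imp_ge_of_dense fun b hb => ?_
      obtain ⟨r, h0, hr⟩ := EReal.lt_iff_exists_rat_btwn.1 hb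
      refine le_trans ?_ hr.le
      refine liminf_le_of_frequently_le' ((h r (by exact_mod_cast h0)).mono fun q hq => ?_)
      exact_mod_cast hq.le
    · exact le_liminf_of_le (by isBoundedDefault)
        (Eventually.of_forall fun q => by exact_mod_cast hf q)

theorem rpow_mul_nearInt_nonneg (θ α : ℝ) (q : ℕ) : 0 ≤ (q : ℝ) ^ θ * nearInt (q * α) :=
  mul_nonneg (by positivity) (nearInt_nonneg _)

theorem le_irrType {α : {x : ℝ // Irrational x}} {θ : ℝ}
    (h : ∀ ε : ℝ, 0 < ε → ∃ᶠ q : ℕ in atTop, (q : ℝ) ^ θ * nearInt (q * α) < ε) :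
    (θ : EReal) ≤ irrType α :=
  le_sSup ⟨θ, (liminf_coe_eq_zero_iff (rpow_mul_nearInt_nonneg θ α)).2 h, rfl⟩

/-- As `q ≥ 1`, the lower bound persists for every larger exponent. -/
theorem irrType_le {α : {x : ℝ // Irrational x}} {θ ε : ℝ} (hε : 0 < ε)
    (h : ∀ᶠ q : ℕ in atTop, ε ≤ (q : ℝ) ^ θ * nearInt (q * α)) :
    irrType α ≤ θ := by
  refine sSup_le ?_
  rintro _ ⟨η, hη, rfl⟩
  replace hη := (liminf_coe_eq_zero_iff (rpow_mul_nearInt_nonneg η α)).1 hη ε hε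
  by_contra hlt
  have hlt : θ < η := EReal.coe_lt_coe_iff.1 (not_le.1 hlt)
  obtain ⟨q, hq, h1, h2⟩ := (hη.and_eventually (h.and (eventually_ge_atTop 1))).exists
  have : (q : ℝ) ^ θ ≤ (q : ℝ) ^ η :=
    Real.rpow_le_rpow_of_exponent_le (by exact_mod_cast h2) hlt.le
  have := mul_le_mul_of_nonneg_right this (nearInt_nonneg (q * α))
  linarith

theorem exists_eventually_of_irrType_lt {α : {x : ℝ // Irrational x}} {θ : ℝ}
    (h : irrType α < θ) :
    ∃ ε : ℝ, 0 < ε ∧ ∀ᶠ q : ℕ in atTop, ε ≤ (q : ℝ) ^ θ * nearInt (q * α) := by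
  by_contra! hc
  refine absurd (le_irrType fun ε hε => ?_) (not_le.2 h)
  simpa [Filter.Frequently] using hc ε hε

/-- Dirichlet supplies `k ≤ n` with `‖k α‖ ≤ 1 / (n + 1)`. Irrationality keeps the finitely many
small `k` away from `0`, so a large `n` forces a large `k`. -/
theorem frequently_rpow_mul_nearInt_lt {α θ ε : ℝ} (hα : Irrational α) (hθ : θ < 1)
    (hε : 0 < ε) : ∃ᶠ q : ℕ in atTop, (q : ℝ) ^ θ * nearInt (q * α) < ε := by
  have hlim : ∀ᶠ q : ℕ in atTop, (q : ℝ) ^ (θ - 1) < ε := by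
    have := (tendsto_rpow_neg_atTop (sub_pos.2 hθ)).comp tendsto_natCast_atTop_atTop
    simpa using this.eventually_lt_const hε
  rw [frequently_atTop]
  intro N
  obtain ⟨M, hM⟩ := eventually_atTop.1 hlim
  have hn : ∀ᶠ n : ℕ in atTop, ∀ q ∈ Finset.range (max N M), 0 < q →
      1 / ((n : ℝ) + 1) < nearInt (q * α) := by
    refine (Filter.eventually_all_finset _).2 fun q _ => ?_
    by_cases hq : 0 < q
    · have hpos := nearInt_pos (hα.natCast_mul hq.ne')
      filter_upwards [tendsto_one_div_add_atTop_nhds_zero_nat.eventually_lt_const hpos]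
        with n hn _ using hn
    · exact Eventually.of_forall fun n h => absurd h hq
  obtain ⟨n, hn, hn0⟩ := (hn.and (eventually_gt_atTop 0)).exists
  obtain ⟨k, hk0, hkn, hk⟩ := Real.exists_nat_abs_mul_sub_round_le α hn0
  rw [← nearInt_eq_abs_sub_round] at hk
  have hkmax : max N M ≤ k := by
    by_contra! hlt
    exact absurd hk (not_le.2 (hn k (Finset.mem_range.2 hlt) hk0))
  refine ⟨k, (le_max_left _ _).trans hkmax, ?_⟩
  have hk0' : (0 : ℝ) < k := by exact_mod_cast hk0
  have hkn' : (k : ℝ) ≤ n := by exact_mod_cast hkn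
  refine lt_of_le_of_lt ?_ (hM k ((le_max_right _ _).trans hkmax))
  rw [Real.rpow_sub_one hk0'.ne', div_eq_mul_inv]
  refine mul_le_mul_of_nonneg_left (hk.trans ?_) (by positivity)
  rw [one_div]
  exact inv_anti₀ hk0' (by linarith)

theorem one_le_irrType (α : {x : ℝ // Irrational x}) : 1 ≤ irrType α := by
  refine le_of_forall_lt_imp_le_of_dense fun b hb => ?_
  obtain ⟨r, hbr, hr⟩ := EReal.lt_iff_exists_rat_btwn.1 hb
  exact hbr.le.trans
    (le_irrType fun ε hε => frequently_rpow_mul_nearInt_lt α.2 (by exact_mod_cast hr) hε)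

/-! ### Sublevel sets of the type function -/

theorem isSigma02_iUnion {X ι : Type*} [TopologicalSpace X] [Countable ι] [Nonempty ι]
    {F : ι → Set X} (hF : ∀ i, IsClosed (F i)) : IsSigma02 (⋃ i, F i) := by
  obtain ⟨e, he⟩ := exists_surjective_nat ι
  exact ⟨fun n => F (e n), fun n => hF _, (he.iUnion_comp F).symm⟩

theorem upperSemiBaireOne_irrType : UpperSemiBaireOne irrType := by
  intro r
  -- Quantifying over all integers `n` replaces `nearInt` by conditions visibly closed in `α`.
  let F : ℚ × ℕ × ℕ → Set {x : ℝ // Irrational x} := fun i =>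
    {α | (i.1 : ℝ) < r ∧ ∀ q : ℕ, i.2.2 ≤ q → ∀ n : ℤ,
      1 / ((i.2.1 : ℝ) + 1) ≤ (q : ℝ) ^ (i.1 : ℝ) * |q * (α : ℝ) - n|}
  have hF : ∀ i, IsClosed (F i) := by
    intro i
    refine isClosed_const.and ?_
    simp only [Set.ofPred_forall]
    refine isClosed_iInter fun q => isClosed_iInter fun _ => isClosed_iInter fun n => ?_
    exact isClosed_le (by fun_prop) (by fun_prop)
  have hset : irrType ⁻¹' Set.Iio (r : EReal) = ⋃ i, F i := by
    ext α
    simp only [Set.mem_preimage, Set.mem_Iio, Set.mem_iUnion]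
    constructor
    · intro h
      obtain ⟨s, hs, hsr⟩ := EReal.lt_iff_exists_rat_btwn.1 h
      obtain ⟨ε, hε, hev⟩ := exists_eventually_of_irrType_lt hs
      obtain ⟨k, hk⟩ := exists_nat_one_div_lt hε
      obtain ⟨N, hN⟩ := eventually_atTop.1 hev
      refine ⟨(s, k, N), by exact_mod_cast hsr, fun q hq n => ?_⟩
      exact hk.le.trans ((hN q hq).trans
        (mul_le_mul_of_nonneg_left (nearInt_le _ _) (by positivity)))
    · rintro ⟨⟨s, k, N⟩, hsr, h⟩
      refine lt_of_le_of_lt (irrType_le (θ := s) (ε := 1 / ((k : ℝ) + 1)) (by positivity) ?_)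
        (by exact_mod_cast hsr)
      filter_upwards [eventually_ge_atTop N] with q hq
      rw [nearInt_eq_abs_sub_round]
      exact h q hq _
  rw [hset]
  exact isSigma02_iUnion hF

/-! ### Upper semi-Baire class 1 functions on the Cantor space as upper limits -/

/-- At time `t`, the first `t` digits of `x` witness that `x` avoids the first `m` closed sets
`F j i` for every `j ≤ k` with `r j ≤ r k`. -/
def AvoidsUpTo (r : ℕ → ℝ) (F : ℕ → ℕ → Set (ℕ → Bool)) (k m t : ℕ) (x : ℕ → Bool) : Prop :=
  m ≤ t ∧ ∀ i < m, ∀ j ≤ k, r j ≤ r k → ∀ y : ℕ → Bool, (∀ l < t, y l = x l) → y ∉ F j i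

/-- At time `t + 1`, the avoidance depth for the index `k` passes some level `m ≥ k`. -/
def DepthIncreases (r : ℕ → ℝ) (F : ℕ → ℕ → Set (ℕ → Bool)) (k t : ℕ) (x : ℕ → Bool) : Prop :=
  ∃ m, k ≤ m ∧ AvoidsUpTo r F k m (t + 1) x ∧ ¬ AvoidsUpTo r F k m t x

section Avoids

variable {r : ℕ → ℝ} {F : ℕ → ℕ → Set (ℕ → Bool)} {k m t : ℕ} {x : ℕ → Bool}

theorem AvoidsUpTo.mono {t' : ℕ} (h : AvoidsUpTo r F k m t x) (htt : t ≤ t') :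
    AvoidsUpTo r F k m t' x :=
  ⟨h.1.trans htt, fun i hi j hj hr y hy => h.2 i hi j hj hr y fun l hl => hy l (hl.trans_le htt)⟩

theorem avoidsUpTo_congr {y : ℕ → Bool} (h : ∀ l < t, x l = y l) :
    AvoidsUpTo r F k m t x ↔ AvoidsUpTo r F k m t y := by
  have key : ∀ z : ℕ → Bool, (∀ l < t, z l = x l) ↔ ∀ l < t, z l = y l := fun z =>
    forall₂_congr fun l hl => by rw [h l hl]
  simp only [AvoidsUpTo, key]

theorem depthIncreases_congr {y : ℕ → Bool} (h : ∀ l < t + 1, x l = y l) :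
    DepthIncreases r F k t x ↔ DepthIncreases r F k t y := by
  simp only [DepthIncreases, avoidsUpTo_congr h,
    avoidsUpTo_congr fun l (hl : l < t) => h l (hl.trans t.lt_succ_self)]

/-- Hence the finite range in `depthValue` misses no index. -/
theorem DepthIncreases.le (h : DepthIncreases r F k t x) : k ≤ t + 1 := by
  obtain ⟨m, hkm, h, -⟩ := h
  exact hkm.trans h.1

theorem AvoidsUpTo.le_of_mem (h : AvoidsUpTo r F k m t x) {i j : ℕ} (hj : j ≤ k)
    (hr : r j ≤ r k) (hx : x ∈ F j i) : m ≤ i := by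
  by_contra! hi
  exact h.2 i hi j hj hr x (fun _ _ => rfl) hx

theorem eventually_not_mem_of_isClosed {A : Set (ℕ → Bool)} (hA : IsClosed A) (hx : x ∉ A) :
    ∀ᶠ t in atTop, ∀ y : ℕ → Bool, (∀ l < t, y l = x l) → y ∉ A := by
  obtain ⟨I, u, hu, hsub⟩ := isOpen_pi_iff.1 hA.isOpen_compl x hx
  filter_upwards [eventually_gt_atTop (I.sup id)] with t ht y hy
  refine hsub fun l hl => ?_
  rw [hy l ((Finset.le_sup (f := id) hl).trans_lt ht)]
  exact (hu l hl).2

theorem eventually_avoidsUpTo (hF : ∀ j i, IsClosed (F j i))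
    (hx : ∀ j, r j ≤ r k → ∀ i, x ∉ F j i) (m : ℕ) :
    ∀ᶠ t in atTop, AvoidsUpTo r F k m t x := by
  refine (eventually_ge_atTop m).and ?_
  refine (eventually_all_finite (Set.finite_lt_nat m)).2 fun i _ =>
    (eventually_all_finite (Set.finite_le_nat k)).2 fun j _ => ?_
  by_cases hr : r j ≤ r k
  · filter_upwards [eventually_not_mem_of_isClosed (hF j i) (hx j hr i)] with t ht _ using ht
  · exact Eventually.of_forall fun t h => absurd h hr

theorem frequently_depthIncreases (hF : ∀ j i, IsClosed (F j i))
    (hx : ∀ j, r j ≤ r k → ∀ i, x ∉ F j i) :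
    ∃ᶠ t in atTop, DepthIncreases r F k t x := by
  rw [frequently_atTop]
  intro T
  -- Level `m` is never reached before time `m`, so the first time this level is reached exceeds
  -- `T`.
  obtain ⟨s, hs⟩ := (eventually_avoidsUpTo hF hx (max (T + 1) k)).exists
  classical
  let p := fun s => AvoidsUpTo r F k (max (T + 1) k) s x
  have hex : ∃ s, p s := ⟨s, hs⟩
  have hfind := Nat.find_spec hex
  have hle : T + 1 ≤ Nat.find hex := (le_max_left _ _).trans hfind.1
  obtain ⟨t, ht⟩ := Nat.exists_eq_add_of_le' (Nat.one_le_of_lt hle)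
  refine ⟨t, by omega, max (T + 1) k, le_max_right _ _, ?_, ?_⟩
  · rw [← ht]; exact hfind
  · exact Nat.find_min hex (m := t) (by omega)

/-- Membership caps the depth at `i`, and each level is passed at most once. -/
theorem eventually_not_depthIncreases_of_mem {i : ℕ} (hx : x ∈ F k i) :
    ∀ᶠ t in atTop, ¬ DepthIncreases r F k t x := by
  have h : ∀ m, ∀ᶠ t in atTop,
      AvoidsUpTo r F k m (t + 1) x → AvoidsUpTo r F k m t x := by
    intro m
    by_cases hm : ∃ s, AvoidsUpTo r F k m s x
    · obtain ⟨s, hs⟩ := hm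
      filter_upwards [eventually_ge_atTop s] with t ht _ using hs.mono ht
    · exact Eventually.of_forall fun t ht => absurd ⟨_, ht⟩ hm
  filter_upwards [(eventually_all_finite (Set.finite_le_nat i)).2 fun m _ => h m] with t ht
  rintro ⟨m, -, h1, h2⟩
  exact h2 (ht m (h1.le_of_mem le_rfl le_rfl hx) h1)

/-- Uniformity in `k`: for `k ≥ j` the set `F j i` containing `x` caps the depth at `i`, while an
increase must pass a level `m ≥ k`. So only `k ≤ max i j` matter. -/
theorem eventually_forall_not_depthIncreases {j : ℕ}
    (hx : ∀ k, r j ≤ r k → ∃ i, x ∈ F k i) :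
    ∀ᶠ t in atTop, ∀ k, r j ≤ r k → ¬ DepthIncreases r F k t x := by
  obtain ⟨i, hi⟩ := hx j le_rfl
  have h : ∀ k, ∀ᶠ t in atTop, r j ≤ r k → ¬ DepthIncreases r F k t x := by
    intro k
    by_cases hk : r j ≤ r k
    · obtain ⟨i, hi⟩ := hx k hk
      filter_upwards [eventually_not_depthIncreases_of_mem hi] with t ht _ using ht
    · exact Eventually.of_forall fun t h => absurd h hk
  filter_upwards [(eventually_all_finite (Set.finite_le_nat (max i j))).2 fun k _ => h k]
    with t ht k hk hd
  refine ht k ?_ hk hd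
  rcases le_total k j with hkj | hkj
  · exact hkj.trans (le_max_right _ _)
  · obtain ⟨m, hkm, hm, -⟩ := hd
    exact (hkm.trans (hm.le_of_mem hkj hk hi)).trans (le_max_left _ _)

end Avoids

open Classical in
/-- The largest `r k` whose avoidance depth increases at time `t`, and at least `1`. -/
noncomputable def depthValue (r : ℕ → ℝ) (F : ℕ → ℕ → Set (ℕ → Bool)) (t : ℕ)
    (x : ℕ → Bool) : ℝ :=
  (Finset.range (t + 2)).sup' Finset.nonempty_range_add_one
    fun k => if DepthIncreases r F k t x then max 1 (r k) else 1

/-- An upper semi-Baire class 1 function on the Cantor space with values at least `1` is the upper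
limit of a sequence of functions the `t`-th of which depends on the first `t + 1` digits only. -/
theorem UpperSemiBaireOne.exists_upper_limit {g : (ℕ → Bool) → EReal} (hg1 : ∀ x, 1 ≤ g x)
    (hg : UpperSemiBaireOne g) :
    ∃ c : ℕ → (ℕ → Bool) → ℝ, (∀ t x, 1 ≤ c t x) ∧
      (∀ t x y, (∀ l < t + 1, x l = y l) → c t x = c t y) ∧
      ∀ x (θ : ℝ), ((θ : EReal) < g x → ∃ᶠ t in atTop, θ < c t x) ∧
        (g x < θ → ∀ᶠ t in atTop, c t x < θ) := by
  obtain ⟨e, he⟩ := exists_surjective_nat ℚ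
  let r : ℕ → ℝ := fun k => e k
  choose F hF hgF using fun k => hg (r k)
  have hmem : ∀ k x, g x < r k ↔ ∃ i, x ∈ F k i := by
    intro k x
    rw [← Set.mem_iUnion, ← hgF k]
    rfl
  refine ⟨depthValue r F, fun t x => ?_, fun t x y hxy => ?_, fun x θ => ⟨fun h => ?_, fun h => ?_⟩⟩
  · refine (Finset.le_sup'_iff _).2 ⟨0, by simp, ?_⟩
    split_ifs
    exacts [le_max_left _ _, le_rfl]
  · classical exact Finset.sup'_congr _ rfl fun k _ => if_congr (depthIncreases_congr hxy) rfl rfl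
  · obtain ⟨s, hs, hsg⟩ := EReal.lt_iff_exists_rat_btwn.1 h
    obtain ⟨k, rfl⟩ := he s
    have hx : ∀ j, r j ≤ r k → ∀ i, x ∉ F j i := by
      intro j hj i hi
      refine absurd ((hmem j x).2 ⟨i, hi⟩) (not_lt.2 (le_trans ?_ hsg.le))
      exact_mod_cast hj
    refine (frequently_depthIncreases hF hx).mono fun t ht => ?_
    refine (Finset.lt_sup'_iff _).2 ⟨k, Finset.mem_range.2 (Nat.lt_succ_of_le ht.le), ?_⟩
    rw [if_pos ht]
    exact lt_max_of_lt_right (by exact_mod_cast hs)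
  · obtain ⟨s, hs, hsθ⟩ := EReal.lt_iff_exists_rat_btwn.1 h
    obtain ⟨j, rfl⟩ := he s
    have hj1 : 1 < r j := EReal.coe_lt_coe_iff.1 ((hg1 x).trans_lt hs)
    have hjθ : r j < θ := by exact_mod_cast hsθ
    have hx : ∀ k, r j ≤ r k → ∃ i, x ∈ F k i := fun k hk =>
      (hmem k x).1 (hs.trans_le (by exact_mod_cast hk))
    filter_upwards [eventually_forall_not_depthIncreases hx] with t ht
    refine (Finset.sup'_lt_iff _).2 fun k _ => lt_trans ?_ hjθ
    split_ifs with hk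
    · exact max_lt hj1 (not_le.1 fun h => ht k h hk)
    · exact hj1

/-! ### Irrational numbers with prescribed growth of the denominators -/

/-- Numerators and denominators `((p', q'), (p, q))` of two consecutive convergents of the
continued fraction with minus signs and partial quotients `5 + ⌊q ^ (c n - 1)⌋`. -/
noncomputable def convPair (c : ℕ → ℝ) : ℕ → (ℤ × ℤ) × (ℤ × ℤ)
  | 0 => ((-1, 0), (0, 1))
  | n + 1 =>
    let s := convPair c n
    let a : ℤ := 5 + ⌊(s.2.2 : ℝ) ^ (c n - 1)⌋
    (s.2, (a * s.2.1 - s.1.1, a * s.2.2 - s.1.2))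

noncomputable def convNum (c : ℕ → ℝ) (n : ℕ) : ℤ := (convPair c n).2.1

noncomputable def convDen (c : ℕ → ℝ) (n : ℕ) : ℤ := (convPair c n).2.2

/-- The limit of the convergents. -/
noncomputable def convLimit (c : ℕ → ℝ) : ℝ := ⨆ n, (convNum c n : ℝ) / convDen c n

theorem convPair_congr {c d : ℕ → ℝ} {n : ℕ} (h : ∀ i < n, c i = d i) :
    convPair c n = convPair d n := by
  induction n with
  | zero => rfl
  | succ n ih =>
    simp only [convPair, ih fun i hi => h i (hi.trans n.lt_succ_self), h n n.lt_succ_self]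

section Conv

variable (c : ℕ → ℝ)

theorem convPair_bounds (n : ℕ) : 0 ≤ (convPair c n).1.2 ∧
    (convPair c n).1.2 ≤ (convPair c n).2.2 ∧ 1 ≤ (convPair c n).2.2 := by
  induction n with
  | zero => simp [convPair]
  | succ n ih =>
    obtain ⟨h0, h1, h2⟩ := ih
    have hpow : (0 : ℝ) ≤ ((convPair c n).2.2 : ℝ) ^ (c n - 1) :=
      Real.rpow_nonneg (by exact_mod_cast zero_le_one.trans h2) _
    have ha := Int.floor_nonneg.2 hpow
    simp only [convPair]
    refine ⟨by omega, ?_, ?_⟩ <;> nlinarith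

theorem one_le_convDen (n : ℕ) : 1 ≤ convDen c n := (convPair_bounds c n).2.2

theorem convDen_pos (n : ℕ) : (0 : ℝ) < convDen c n := by
  exact_mod_cast zero_lt_one.trans_le (one_le_convDen c n)

/-- The subtracted denominator lies between `0` and `q_n`, costing at most one unit of the partial
quotient. The summand `5` thus leaves a growth factor of at least `4`. -/
theorem convDen_succ_bounds (n : ℕ) :
    (4 + ⌊(convDen c n : ℝ) ^ (c n - 1)⌋) * convDen c n ≤ convDen c (n + 1) ∧
    convDen c (n + 1) ≤ (5 + ⌊(convDen c n : ℝ) ^ (c n - 1)⌋) * convDen c n := by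
  obtain ⟨h0, h1, h2⟩ := convPair_bounds c n
  simp only [convDen, convPair]
  constructor <;> linarith

theorem four_mul_convDen_le (n : ℕ) : 4 * convDen c n ≤ convDen c (n + 1) := by
  have ha := Int.floor_nonneg.2 (Real.rpow_nonneg (convDen_pos c n).le (c n - 1))
  have := (convDen_succ_bounds c n).1
  nlinarith [one_le_convDen c n]

theorem four_mul_convDen_le_real (n : ℕ) : 4 * (convDen c n : ℝ) ≤ convDen c (n + 1) := by
  exact_mod_cast four_mul_convDen_le c n

theorem natCast_lt_convDen (n : ℕ) : (n : ℤ) < convDen c n := by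
  induction n with
  | zero => exact one_le_convDen c 0
  | succ n ih =>
    have := four_mul_convDen_le c n
    push_cast
    omega

theorem convDen_monotone : Monotone (convDen c) :=
  monotone_nat_of_le_succ fun n => by
    have := four_mul_convDen_le c n
    have := one_le_convDen c n
    omega

theorem tendsto_convDen : Tendsto (fun n => (convDen c n : ℝ)) atTop atTop :=
  tendsto_atTop_mono (fun n => by exact_mod_cast (natCast_lt_convDen c n).le)
    tendsto_natCast_atTop_atTop

theorem rpow_le_convDen_succ (n : ℕ) : (convDen c n : ℝ) ^ c n ≤ convDen c (n + 1) := by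
  have hpos := convDen_pos c n
  have h1 : ((4 : ℝ) + ⌊(convDen c n : ℝ) ^ (c n - 1)⌋) * convDen c n ≤ convDen c (n + 1) := by
    exact_mod_cast (convDen_succ_bounds c n).1
  have h2 := Int.lt_floor_add_one ((convDen c n : ℝ) ^ (c n - 1))
  have h3 : (convDen c n : ℝ) ^ c n = (convDen c n : ℝ) ^ (c n - 1) * convDen c n := by
    rw [Real.rpow_sub_one hpos.ne']; field_simp
  rw [h3]
  refine le_trans (mul_le_mul_of_nonneg_right ?_ hpos.le) h1
  linarith

theorem convDen_succ_le {n : ℕ} (hc : 1 ≤ c n) :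
    (convDen c (n + 1) : ℝ) ≤ 6 * (convDen c n : ℝ) ^ c n := by
  have hpos := convDen_pos c n
  have h1 : (convDen c (n + 1) : ℝ) ≤
      ((5 : ℝ) + ⌊(convDen c n : ℝ) ^ (c n - 1)⌋) * convDen c n := by
    exact_mod_cast (convDen_succ_bounds c n).2
  have h2 := Int.floor_le ((convDen c n : ℝ) ^ (c n - 1))
  have h3 : (convDen c n : ℝ) ^ c n = (convDen c n : ℝ) ^ (c n - 1) * convDen c n := by
    rw [Real.rpow_sub_one hpos.ne']; field_simp
  -- This absorbs the summand `5`, giving the constant `6`.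
  have h4 : 1 ≤ (convDen c n : ℝ) ^ (c n - 1) :=
    Real.one_le_rpow (by exact_mod_cast one_le_convDen c n) (by linarith)
  rw [h3, ← mul_assoc]
  refine h1.trans (mul_le_mul_of_nonneg_right ?_ hpos.le)
  linarith

/-- The minus signs keep the determinant at `1` instead of alternating, so the convergents increase.
-/
theorem convNum_mul_convDen_sub (n : ℕ) :
    convNum c (n + 1) * convDen c n - convNum c n * convDen c (n + 1) = 1 := by
  have h : ∀ n, (convPair c n).2.1 * (convPair c n).1.2 -
      (convPair c n).1.1 * (convPair c n).2.2 = 1 := by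
    intro n
    induction n with
    | zero => simp [convPair]
    | succ n ih =>
      simp only [convPair]
      linarith
  exact h (n + 1)

theorem conv_succ_eq (n : ℕ) : (convNum c (n + 1) : ℝ) / convDen c (n + 1) =
    convNum c n / convDen c n + 1 / (convDen c n * convDen c (n + 1)) := by
  have h0 := (convDen_pos c n).ne'
  have h1 := (convDen_pos c (n + 1)).ne'
  have h : (convNum c (n + 1) : ℝ) * convDen c n - convNum c n * convDen c (n + 1) = 1 := by
    exact_mod_cast convNum_mul_convDen_sub c n
  field_simp
  linarith

/-- These intervals are nested: the upper ends decrease because `2 q_n ≤ q_{n+2}`. -/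
theorem convLimit_mem_Icc (n : ℕ) : convLimit c ∈ Set.Icc ((convNum c n : ℝ) / convDen c n)
    (convNum c n / convDen c n + 2 / (convDen c n * convDen c (n + 1))) := by
  have hmono : Monotone fun n => (convNum c n : ℝ) / convDen c n := by
    refine monotone_nat_of_le_succ fun n => ?_
    have h0 := convDen_pos c n
    have h1 := convDen_pos c (n + 1)
    rw [conv_succ_eq]
    exact le_add_of_nonneg_right (by positivity)
  have hanti : Antitone fun n => (convNum c n : ℝ) / convDen c n +
      2 / (convDen c n * convDen c (n + 1)) := by
    refine antitone_nat_of_succ_le fun n => ?_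
    have h0 := convDen_pos c n
    have h1 := convDen_pos c (n + 1)
    have h2 := convDen_pos c (n + 2)
    have h3 := four_mul_convDen_le_real c n
    have h4 := four_mul_convDen_le_real c (n + 1)
    rw [conv_succ_eq, add_assoc]
    refine add_le_add le_rfl ?_
    have h5 : (2 : ℝ) / (convDen c (n + 1) * convDen c (n + 2)) ≤
        1 / (convDen c n * convDen c (n + 1)) := by
      rw [div_le_div_iff₀ (by positivity) (by positivity)]
      nlinarith
    calc _ ≤ 1 / ((convDen c n : ℝ) * convDen c (n + 1)) +
          1 / ((convDen c n : ℝ) * convDen c (n + 1)) := add_le_add le_rfl h5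
      _ = _ := by ring
  have hle : ∀ n, (convNum c n : ℝ) / convDen c n ≤
      convNum c n / convDen c n + 2 / (convDen c n * convDen c (n + 1)) := by
    intro n
    have h0 := convDen_pos c n
    have h1 := convDen_pos c (n + 1)
    exact le_add_of_nonneg_right (by positivity)
  exact Set.mem_iInter.1 (hmono.ciSup_mem_iInter_Icc_of_antitone hanti hle) n

theorem nearInt_convDen_mul_le (n : ℕ) :
    nearInt (convDen c n * convLimit c) ≤ 2 / convDen c (n + 1) := by
  have h0 := convDen_pos c n
  have h1 := convDen_pos c (n + 1)
  obtain ⟨hl, hu⟩ := convLimit_mem_Icc c n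
  refine (nearInt_le _ (convNum c n)).trans ?_
  have he : convDen c n * convLimit c - convNum c n =
      convDen c n * (convLimit c - convNum c n / convDen c n) := by
    field_simp
  rw [he, abs_of_nonneg (mul_nonneg h0.le (by linarith))]
  calc _ ≤ (convDen c n : ℝ) * (2 / (convDen c n * convDen c (n + 1))) :=
        mul_le_mul_of_nonneg_left (by linarith) h0.le
    _ = _ := by field_simp

/-- By coprimality `q p_n - p q_n` is a nonzero integer, so `q p_n / q_n` is at least `1 / q_n` from
`p`. Passing to the limit costs at most half of this. -/
theorem le_abs_mul_convLimit_sub {q : ℤ} {n : ℕ} (hq : 0 < q) (hqn : q < convDen c n) (p : ℤ) :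
    1 / (2 * (convDen c n : ℝ)) ≤ |q * convLimit c - p| := by
  have h0 := convDen_pos c n
  have h1 := convDen_pos c (n + 1)
  have h4 := four_mul_convDen_le_real c n
  have hq0 : (0 : ℝ) < q := by exact_mod_cast hq
  have hqn' : (q : ℝ) < convDen c n := by exact_mod_cast hqn
  obtain ⟨hl, hu⟩ := convLimit_mem_Icc c n
  have hne : q * convNum c n - p * convDen c n ≠ 0 := by
    intro h
    have hcop : IsCoprime (convDen c n) (convNum c n) :=
      ⟨convNum c (n + 1), -convDen c (n + 1), by
        linarith [convNum_mul_convDen_sub c n]⟩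
    have hdvd : convDen c n ∣ q :=
      hcop.dvd_of_dvd_mul_right ⟨p, by linarith⟩
    exact absurd (Int.le_of_dvd hq hdvd) (not_le.2 hqn)
  have hone : (1 : ℝ) ≤ |(q : ℝ) * convNum c n - p * convDen c n| := by
    exact_mod_cast Int.one_le_abs hne
  set δ := convLimit c - convNum c n / convDen c n with hδ
  have hδ0 : 0 ≤ δ := by linarith
  have hδ1 : q * δ ≤ 1 / (2 * (convDen c n : ℝ)) := by
    calc q * δ ≤ convDen c n * (2 / (convDen c n * convDen c (n + 1))) :=
          mul_le_mul hqn'.le (by linarith) hδ0 h0.le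
      _ = 2 / convDen c (n + 1) := by field_simp
      _ ≤ _ := by
        rw [div_le_div_iff₀ h1 (by positivity)]
        linarith
  have heq : q * convLimit c - p =
      ((q : ℝ) * convNum c n - p * convDen c n) / convDen c n + q * δ := by
    rw [hδ]; field_simp; ring
  have habs : 1 / (convDen c n : ℝ) ≤
      |((q : ℝ) * convNum c n - p * convDen c n) / convDen c n| := by
    rw [abs_div, abs_of_pos h0]
    exact div_le_div_of_nonneg_right hone h0.le
  have htri := abs_sub_abs_le_abs_add
    (((q : ℝ) * convNum c n - p * convDen c n) / convDen c n) (q * δ)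
  rw [abs_of_nonneg (mul_nonneg hq0.le hδ0)] at htri
  rw [heq]
  have : 1 / (convDen c n : ℝ) = 1 / (2 * (convDen c n : ℝ)) + 1 / (2 * (convDen c n : ℝ)) := by
    field_simp; norm_num
  linarith

theorem irrational_convLimit : Irrational (convLimit c) := by
  rw [irrational_iff_ne_rational]
  intro a b hb h
  have key : ∀ a b : ℤ, 0 < b → convLimit c ≠ a / b := by
    intro a b hb h
    have hlt : b < convDen c b.toNat := by
      have := natCast_lt_convDen c b.toNat
      omega
    have h1 := le_abs_mul_convLimit_sub c hb hlt a
    have hb' : (b : ℝ) ≠ 0 := by exact_mod_cast hb.ne'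
    rw [h, mul_div_cancel₀ _ hb', sub_self, abs_zero] at h1
    have := convDen_pos c b.toNat
    exact absurd h1 (not_le.2 (by positivity))
  rcases hb.lt_or_gt with hb | hb
  · refine key (-a) (-b) (by omega) ?_
    rw [h]; push_cast; rw [neg_div_neg_eq]
  · exact key a b hb h

/-- The limit of the convergents as an element of the space of irrational numbers. -/
noncomputable def convIrrational : {x : ℝ // Irrational x} := ⟨convLimit c, irrational_convLimit c⟩

theorem exists_convDen_le_lt {q : ℕ} (hq : 0 < q) :
    ∃ n, convDen c n ≤ q ∧ (q : ℤ) < convDen c (n + 1) := by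
  classical
  have hex : ∃ n, (q : ℤ) < convDen c n := ⟨q, natCast_lt_convDen c q⟩
  have hpos : Nat.find hex ≠ 0 := by
    intro h0
    have h := Nat.find_spec hex
    rw [h0] at h
    simp only [convDen, convPair] at h
    omega
  obtain ⟨n, hn⟩ := Nat.exists_eq_succ_of_ne_zero hpos
  refine ⟨n, not_lt.1 (Nat.find_min hex (by omega)), ?_⟩
  have h := Nat.find_spec hex
  rwa [hn] at h

variable {c}

/-- Tested on `q = q_n`, where `‖q_n α‖ ≤ 2 / q_{n+1} ≤ 2 q_n ^ (-η)`. -/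
theorem le_irrType_convIrrational {θ η : ℝ} (hθη : θ < η) (h : ∃ᶠ n in atTop, η < c n) :
    (θ : EReal) ≤ irrType (convIrrational c) := by
  refine le_irrType fun ε hε => ?_
  have hlim : ∀ᶠ n in atTop, 2 * (convDen c n : ℝ) ^ (θ - η) < ε := by
    have := ((tendsto_rpow_neg_atTop (sub_pos.2 hθη)).comp (tendsto_convDen c)).const_mul 2
    simpa using this.eventually_lt_const (u := ε) (by simpa using hε)
  have htend : Tendsto (fun n => (convDen c n).toNat) atTop atTop :=
    tendsto_atTop_mono (fun n => by
      have := natCast_lt_convDen c n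
      show n ≤ _
      omega) tendsto_id
  refine htend.frequently ((h.and_eventually hlim).mono ?_)
  rintro n ⟨hn, hsmall⟩
  have h0 := convDen_pos c n
  have hcast : (((convDen c n).toNat : ℕ) : ℝ) = convDen c n := by
    exact_mod_cast Int.toNat_of_nonneg (zero_le_one.trans (one_le_convDen c n))
  rw [hcast]
  refine lt_of_le_of_lt ?_ hsmall
  have h1 : (convDen c n : ℝ) ^ η ≤ convDen c (n + 1) :=
    (Real.rpow_le_rpow_of_exponent_le (by exact_mod_cast one_le_convDen c n) hn.le).trans
      (rpow_le_convDen_succ c n)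
  have hη : 0 < (convDen c n : ℝ) ^ η := Real.rpow_pos_of_pos h0 _
  calc (convDen c n : ℝ) ^ θ * nearInt (convDen c n * convLimit c)
      ≤ (convDen c n : ℝ) ^ θ * (2 / (convDen c n : ℝ) ^ η) :=
        mul_le_mul_of_nonneg_left ((nearInt_convDen_mul_le c n).trans
          (div_le_div_of_nonneg_left zero_le_two hη h1)) (by positivity)
    _ = 2 * (convDen c n : ℝ) ^ (θ - η) := by rw [Real.rpow_sub h0]; ring

/-- For `q_n ≤ q < q_{n+1}` one has `‖q α‖ ≥ 1 / (2 q_{n+1}) ≥ 1 / (12 q_n ^ θ) ≥ 1 / (12 q ^ θ)`.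
-/
theorem irrType_convIrrational_le {θ : ℝ} (hc : ∀ n, 1 ≤ c n) (h : ∀ᶠ n in atTop, c n < θ) :
    irrType (convIrrational c) ≤ θ := by
  refine irrType_le (ε := 1 / 12) (by norm_num) ?_
  obtain ⟨N, hN⟩ := eventually_atTop.1 h
  filter_upwards [eventually_ge_atTop (convDen c N).toNat, eventually_gt_atTop 0] with q hq hq0
  obtain ⟨n, hnq, hqn⟩ := exists_convDen_le_lt c hq0
  have hNn : N ≤ n := by
    by_contra! hlt
    have := convDen_monotone c (Nat.succ_le_of_lt hlt)
    simp only [Nat.succ_eq_add_one] at this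
    omega
  have hcn := hN n hNn
  have h0 := convDen_pos c n
  have hθ : 0 ≤ θ := by linarith [hc n]
  have h1 := le_abs_mul_convLimit_sub c (q := q) (by exact_mod_cast hq0) hqn
    (round ((q : ℝ) * convLimit c))
  rw [Int.cast_natCast, ← nearInt_eq_abs_sub_round] at h1
  have hpow : (convDen c n : ℝ) ^ θ ≤ (q : ℝ) ^ θ :=
    Real.rpow_le_rpow h0.le (by exact_mod_cast hnq) hθ
  have hθpos : 0 < (convDen c n : ℝ) ^ θ := Real.rpow_pos_of_pos h0 _
  have hden : (convDen c (n + 1) : ℝ) ≤ 6 * (convDen c n : ℝ) ^ θ :=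
    (convDen_succ_le c (hc n)).trans (mul_le_mul_of_nonneg_left
      (Real.rpow_le_rpow_of_exponent_le (by exact_mod_cast one_le_convDen c n) hcn.le)
      (by norm_num))
  have hinv : 1 / (2 * (6 * (convDen c n : ℝ) ^ θ)) ≤ 1 / (2 * (convDen c (n + 1) : ℝ)) := by
    have := convDen_pos c (n + 1)
    exact one_div_le_one_div_of_le (by positivity) (by linarith)
  calc (1 / 12 : ℝ) = (convDen c n : ℝ) ^ θ * (1 / (2 * (6 * (convDen c n : ℝ) ^ θ))) := by
        field_simp; norm_num
    _ ≤ (q : ℝ) ^ θ * nearInt (q * convLimit c) :=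
        mul_le_mul hpow (hinv.trans h1) (by positivity) (by positivity)

end Conv

/-! ### Continuous dependence on the exponents, and completeness -/

theorem abs_convLimit_sub_le {c d : ℕ → ℝ} {n : ℕ} (h : ∀ i < n, c i = d i) :
    |convLimit c - convLimit d| ≤ 2 / convDen c n := by
  have key : ∀ c : ℕ → ℝ, convLimit c ∈ Set.Icc ((convNum c n : ℝ) / convDen c n)
      (convNum c n / convDen c n + 2 / convDen c n) := by
    intro c
    obtain ⟨hl, hu⟩ := convLimit_mem_Icc c n
    refine ⟨hl, hu.trans (add_le_add le_rfl ?_)⟩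
    have h0 := convDen_pos c n
    have h1 : (1 : ℝ) ≤ convDen c (n + 1) := by exact_mod_cast one_le_convDen c (n + 1)
    exact div_le_div_of_nonneg_left zero_le_two h0 (le_mul_of_one_le_right h0.le h1)
  have hc := key c
  have hd := key d
  have hp : convNum c n = convNum d n := by rw [convNum, convNum, convPair_congr h]
  have hq : convDen c n = convDen d n := by rw [convDen, convDen, convPair_congr h]
  rw [← hp, ← hq] at hd
  rw [abs_le]
  constructor <;> linarith [hc.1, hc.2, hd.1, hd.2]

theorem continuous_convIrrational {c : ℕ → (ℕ → Bool) → ℝ}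
    (hc : ∀ t x y, (∀ l < t + 1, x l = y l) → c t x = c t y) :
    Continuous fun x => convIrrational fun t => c t x := by
  refine Continuous.subtype_mk (continuous_iff_continuousAt.2 fun x => ?_) _
  rw [ContinuousAt, Metric.tendsto_nhds]
  intro ε hε
  obtain ⟨n, hn⟩ := ((tendsto_convDen fun t => c t x).eventually_gt_atTop (2 / ε)).exists
  have hev : ∀ᶠ y in 𝓝 x, ∀ l ∈ {l | l < n}, y l = x l := by
    refine (eventually_all_finite (Set.finite_lt_nat n)).2 fun l _ => ?_
    exact (continuous_apply l).continuousAt.eventually_mem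
      (by simp : ({x l} : Set Bool) ∈ 𝓝 (x l))
  filter_upwards [hev] with y hy
  rw [dist_comm, Real.dist_eq]
  refine (abs_convLimit_sub_le (n := n) fun t ht => ?_).trans_lt ?_
  · exact hc t x y fun l hl => (hy l (show l < n by omega)).symm
  · exact (div_lt_comm₀ hε (convDen_pos _ n)).1 hn

theorem theorem4 :
    UpperSemiBaireOneComplete (Set.Icc (1 : EReal) ⊤) irrType := by
  refine ⟨fun α => ⟨one_le_irrType α, le_top⟩, upperSemiBaireOne_irrType, fun g hg1 hg => ?_⟩
  obtain ⟨c, hc1, hcont, hlim⟩ := hg.exists_upper_limit fun x => (hg1 x).1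
  refine ⟨fun x => convIrrational fun t => c t x, continuous_convIrrational hcont, ?_⟩
  funext x
  apply le_antisymm
  -- Comparing through rationals strictly in between also covers the value `⊤`.
  · refine le_of_forall_lt_imp_le_of_dense fun b hb => ?_
    obtain ⟨s, hbs, hs⟩ := EReal.lt_iff_exists_rat_btwn.1 hb
    obtain ⟨u, hsu, hu⟩ := EReal.lt_iff_exists_rat_btwn.1 hs
    exact hbs.le.trans
      (le_irrType_convIrrational (by exact_mod_cast hsu) ((hlim x u).1 hu))
  · refine le_of_forall_gt_imp_ge_of_dense fun b hb => ?_
    obtain ⟨s, hs, hsb⟩ := EReal.lt_iff_exists_rat_btwn.1 hb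
    exact (irrType_convIrrational_le (fun n => hc1 n x) ((hlim x s).2 hs)).trans hsb.le
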